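/- \textbf{Bin packing with untrusted advice.} An instance of online bin packing is a finite sequence $\sigma$ of item sizes in $(0,1]$; each arriving item must be placed irrevocably in a bin of capacity $1$, and the cost is the number of bins used. $\mathrm{Opt}(\sigma)$ is the optimal offline cost. A deterministic online algorithm $A$ with advice determines the bin of each item from the items that have arrived so far (including the current one) and an advice string $\varphi\in\{0,1\}^*$; its cost is $A(\sigma,\varphi)$, and for every $\sigma$ and $\varphi$ it must produce a valid packing. It has advice complexity $s(n)$ if on inputs of length $n$ it depends only on the first $s(n)$ bits of $\varphi$. Ratios are asymptotic: the competitive ratio of $A$ with trusted advice is at most $r$ if there is a constant $d$ such that for all $\sigma$, $\min_\varphi A(\sigma,\varphi)\le r\,\mathrm{Opt}(\sigma)+d$; with untrusted advice it is at most $w$ if there is a constant $d$ such that for all $\sigma$ and all $\varphi$, $A(\sigma,\varphi)\le w\,\mathrm{Opt}(\sigma)+d$. $A$ is $(r,w)$-competitive if both hold. \textbf{The algorithm.} Items are \emph{tiny} (size in $(0,1/3]$), \emph{small} ($(1/3,1/2]$), \emph{critical} ($(1/2,2/3]$) or \emph{large} ($(2/3,1]$). For $\alpha\in[0,1]$, the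 algorithm $\textsc{Rrc}_\alpha$ reads from the advice string a fraction $\gamma=\sum_i \varphi_i2^{-i}$, and $\textsc{Rrc}_{\alpha,k}$ uses only the first $k$ bits of the string for this (missing bits count as $0$). Put $\beta=\min\{\alpha,\gamma\}$. Each large item is packed alone in a large bin, and small items are packed in pairs in small bins. A critical item is placed in the first critical bin that has no critical item, or in a new critical bin if there is none. A tiny item is placed by First-Fit into the critical bins, where the tiny items of a critical bin may have total size at most $1/3$; if this fails, by First-Fit into the tiny bins; if this fails too, a new bin is opened for it, which is declared critical if $c'/(c'+t')<\beta$ and tiny otherwise, where $c'$ and $t'$ are the current numbers of critical and tiny bins (and $0/0:=0$). \textbf{Theorem.} For all $\alpha\in[0,1]$ and $k\in\mathbb N$, $\textsc{Rrc}_{\alpha,k}$ always produces a valid packing and has advice complexity $k$ (so it uses $O(k)$ advice bits); its competitive ratio is at most $$1.5+\max\Big\{\frac{1-\alpha}{4-3\alpha},\ \frac{15}{2^{k/2+1}}\Big\}\quad\text{with trusted advice, and at most}\quad 1.5+\max\Big\{\frac14,\ \frac{9\alpha}{8-6\alpha}\Big\}\quad\text{with untrusted advice.}$$ Consequently, for every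 $r\ge 1.5$ there is $\alpha\in[0,1]$ such that $\textsc{Rrc}_\alpha$ (with advice strings of arbitrary length) is $(r,\max\{33-18r,\,7/4\})$-competitive, and if $r>1.5$, then for some constant $k$ already $\textsc{Rrc}_{\alpha,k}$ is. -/

import Mathlib

/-! ## Online bin packing with advice -/

/-- A bin packing instance: a finite sequence of item sizes in `(0, 1]`. -/
def IsInstance (σ : List ℝ) : Prop := ∀ x ∈ σ, 0 < x ∧ x ≤ 1

/-- An assignment of the items of `σ` to bins (named by natural numbers) is a packing if no bin
receives items of total size more than `1`. -/
def IsPacking (σ : List ℝ) (p : Fin σ.length → ℕ) : Prop :=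
  ∀ b : ℕ, ∑ i ∈ Finset.univ.filter (fun i => p i = b), σ.get i ≤ 1

/-- Number of bins used by an assignment. -/
def numBins {n : ℕ} (p : Fin n → ℕ) : ℕ := (Finset.univ.image p).card

/-- The optimal offline cost: the least number of bins of a packing of `σ`. -/
noncomputable def binOpt (σ : List ℝ) : ℕ :=
  sInf {m : ℕ | ∃ p : Fin σ.length → ℕ, IsPacking σ p ∧ numBins p = m}

/-- A deterministic online algorithm with an advice tape: from the requests that have arrived so
far (the last one is the current request) and the advice string, it determines the bin of the
current request. -/
abbrev OnlineAlg := List ℝ → List Bool → ℕ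

namespace OnlineAlg

/-- The assignment produced on `σ` with advice `φ`; the `i`-th decision sees only the requests up
to and including the `i`-th. -/
def packing (A : OnlineAlg) (σ : List ℝ) (φ : List Bool) : Fin σ.length → ℕ :=
  fun i => A (σ.take (i + 1)) φ

/-- The cost `A(σ, φ)`. -/
def cost (A : OnlineAlg) (σ : List ℝ) (φ : List Bool) : ℕ := numBins (A.packing σ φ)

/-- The algorithm always produces a packing, whatever the advice. -/
def Feasible (A : OnlineAlg) : Prop :=
  ∀ σ : List ℝ, IsInstance σ → ∀ φ : List Bool, IsPacking σ (A.packing σ φ)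

/-- On inputs of length `n` the algorithm depends only on the first `s n` bits of advice. -/
def HasAdviceComplexity (A : OnlineAlg) (s : ℕ → ℕ) : Prop :=
  ∀ (σ : List ℝ) (φ ψ : List Bool), φ.take (s σ.length) = ψ.take (s σ.length) →
    A.packing σ φ = A.packing σ ψ

/-- The (asymptotic) competitive ratio with trusted advice, `sup_σ inf_φ A(σ,φ) / Opt(σ)`, is at
most `r`. -/
def TrustedRatioLE (A : OnlineAlg) (r : ℝ) : Prop :=
  ∃ d : ℝ, ∀ σ : List ℝ, IsInstance σ → ∃ φ : List Bool, (A.cost σ φ : ℝ) ≤ r * binOpt σ + d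

/-- The (asymptotic) competitive ratio with untrusted advice, `sup_σ sup_φ A(σ,φ) / Opt(σ)`, is at
most `w`. -/
def UntrustedRatioLE (A : OnlineAlg) (w : ℝ) : Prop :=
  ∃ d : ℝ, ∀ σ : List ℝ, IsInstance σ → ∀ φ : List Bool, (A.cost σ φ : ℝ) ≤ w * binOpt σ + d

/-- `A` is a (feasible) `(r, w)`-competitive algorithm. -/
def IsCompetitive (A : OnlineAlg) (r w : ℝ) : Prop :=
  A.Feasible ∧ A.TrustedRatioLE r ∧ A.UntrustedRatioLE w

end OnlineAlg

/-! ## The algorithm -/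

namespace RRC

/-- The four kinds of bins. Items are classified as tiny `(0,1/3]`, small `(1/3,1/2]`,
critical `(1/2,2/3]` and large `(2/3,1]`. -/
inductive Kind
  | tiny
  | small
  | critical
  | large

/-- An open bin: its declared kind and its items. -/
structure Bin where
  kind : Kind
  items : List ℝ

/-- Total size of the items in a bin. -/
noncomputable def Bin.level (b : Bin) : ℝ := b.items.sum

open scoped Classical in
/-- Total size of the tiny items in a bin. -/
noncomputable def Bin.tinyLevel (b : Bin) : ℝ := (b.items.filter (fun y => y ≤ 1 / 3)).sum

/-- The bin contains an item larger than `1/2` (in a critical bin: a critical item). -/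
def Bin.HasCritical (b : Bin) : Prop := ∃ y ∈ b.items, 1 / 2 < y

open scoped Classical in
/-- Index of the first bin (in order of opening) that satisfies `P`, or the number of open bins if
there is none. -/
noncomputable def firstIdx (L : List Bin) (P : Bin → Prop) : ℕ := L.findIdx (fun b => P b)

open scoped Classical in
/-- Number of open bins of the given kind. -/
noncomputable def countKind (L : List Bin) (κ : Kind) : ℕ := L.countP (fun b => b.kind = κ)

open scoped Classical in
/-- The index of the bin that receives `x` when the open bins are `L`; the value `L.length` means
that a new bin is opened. Large items are packed alone, small items in pairs, a critical item goes
to a critical bin that has no critical item yet, and a tiny item is packed by First-Fit into the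
critical bins, where tiny items may have total size at most `1/3`, and if this fails by First-Fit
into the tiny bins. -/
noncomputable def place (L : List Bin) (x : ℝ) : ℕ :=
  if 2 / 3 < x then L.length
  else if 1 / 2 < x then firstIdx L (fun b => b.kind = Kind.critical ∧ ¬ b.HasCritical)
  else if 1 / 3 < x then firstIdx L (fun b => b.kind = Kind.small ∧ b.items.length < 2)
  else if ∃ b ∈ L, b.kind = Kind.critical ∧ b.tinyLevel + x ≤ 1 / 3 then
    firstIdx L (fun b => b.kind = Kind.critical ∧ b.tinyLevel + x ≤ 1 / 3)
  else firstIdx L (fun b => b.kind = Kind.tiny ∧ b.level + x ≤ 1)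

open scoped Classical in
/-- The kind of a new bin opened for `x`. A bin opened for a tiny item is declared critical if
`c' / (c' + t') < β`, where `c'` and `t'` are the numbers of critical and tiny bins open so far
(`0 / 0` is read as `0`), and tiny otherwise. -/
noncomputable def newKind (β : ℝ) (L : List Bin) (x : ℝ) : Kind :=
  if 2 / 3 < x then Kind.large
  else if 1 / 2 < x then Kind.critical
  else if 1 / 3 < x then Kind.small
  else if (countKind L Kind.critical : ℝ) /
      ((countKind L Kind.critical : ℝ) + (countKind L Kind.tiny : ℝ)) < β then Kind.critical
  else Kind.tiny

/-- Serve one item. -/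
noncomputable def step (β : ℝ) (L : List Bin) (x : ℝ) : List Bin :=
  if place L x < L.length then
    L.modify (place L x) (fun b => { kind := b.kind, items := b.items ++ [x] })
  else L ++ [{ kind := newKind β L x, items := [x] }]

/-- The open bins after serving a sequence. -/
noncomputable def run (β : ℝ) (σ : List ℝ) : List Bin := σ.foldl (step β) []

/-- The fraction `γ = ∑ᵢ bᵢ 2⁻ⁱ` (`i = 1, 2, …`) encoded in binary by a string of bits. -/
noncomputable def fraction : List Bool → ℝ
  | [] => 0
  | b :: l => ((if b then 1 else 0) + fraction l) / 2

/-- The algorithm with parameter `α`, reading the fraction `γ` from its whole advice string; it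
maintains the ratio `β = min α γ`. -/
noncomputable def rrcTape (α : ℝ) : OnlineAlg :=
  fun σ φ => place (run (min α (fraction φ)) σ.dropLast) (σ.getLastD 0)

/-- The algorithm with parameter `α` and `k` bits of advice: `γ` is the multiple of `2⁻ᵏ` encoded by
the first `k` bits (missing bits count as `0`). -/
noncomputable def rrc (α : ℝ) (k : ℕ) : OnlineAlg :=
  fun σ φ => rrcTape α σ (φ.take k)

end RRC

/-!
First-Fit fills the tiny bins to `2/3` on average, and, as soon as some tiny item fits into no
critical bin, the critical bins are filled with tiny items to half of their allotted `1/3` on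
average. It is the last opening of a bin that carries the information: the last tiny bin was opened
while critical bins made up a fraction at least `β`, and, if some critical bin never received a
critical item, the last critical bin was opened while they made up a fraction less than `β`.

If every critical bin has a critical item, the first fact gives the ratio
`1.5 + (1 - β) / (4 - 3 * β)`, by linear programming duality with the volume bound and the bounds
on the number of items larger than `1/2`, respectively `1/3`. Otherwise the second fact and the
volume bound give `1.5 + 9 * β / (8 - 6 * β)`. Since `β ≤ α`, this is the untrusted bound.

With trusted advice, choose `j` such that there are at most as many critical bins as critical
items for `γ = j / 2 ^ k`, but more for `γ = (j + 1) / 2 ^ k`, or such that `j + 1 = 2 ^ k`, when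
`γ` is as good as `1`. In the former case the second packing certifies that the input has many tiny
items for its number of critical items, which bounds the first packing by `1.5 + 6 * s`, where
`s = 2 ^ (-k / 2)`, as long as `β ≥ s`; for `β < s` the second packing is itself good enough.
-/

theorem exists_isPacking_numBins_eq_binOpt {σ : List ℝ} (hσ : IsInstance σ) :
    ∃ p : Fin σ.length → ℕ, IsPacking σ p ∧ numBins p = binOpt σ := by
  refine Nat.sInf_mem (s := {m | ∃ p : Fin σ.length → ℕ, IsPacking σ p ∧ numBins p = m})
    ⟨_, fun i => i, fun b => ?_, rfl⟩
  have hcard : (Finset.univ.filter fun i : Fin σ.length => (i : ℕ) = b).card ≤ 1 :=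
    Finset.card_le_one.2 fun i hi j hj => by simp_all [Fin.ext_iff]
  calc ∑ i ∈ Finset.univ.filter (fun i : Fin σ.length => (i : ℕ) = b), σ.get i
      ≤ (Finset.univ.filter fun i : Fin σ.length => (i : ℕ) = b).card • (1 : ℝ) :=
        Finset.sum_le_card_nsmul _ _ _ fun i _ => (hσ _ (List.get_mem _ _)).2
    _ ≤ 1 := by simpa using hcard

theorem sum_map_le_mul_binOpt {σ : List ℝ} (hσ : IsInstance σ) {w : ℝ → ℝ} {ρ : ℝ}
    (hw : ∀ s : Finset (Fin σ.length), ∑ i ∈ s, σ.get i ≤ 1 → ∑ i ∈ s, w (σ.get i) ≤ ρ) :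
    (σ.map w).sum ≤ ρ * binOpt σ := by
  obtain ⟨p, hp, hpopt⟩ := exists_isPacking_numBins_eq_binOpt hσ
  calc (σ.map w).sum
      = ∑ i, w (σ.get i) := (Fin.sum_univ_fun_getElem σ w).symm
    _ = ∑ b ∈ Finset.univ.image p, ∑ i ∈ Finset.univ.filter (fun i => p i = b), w (σ.get i) :=
        (Finset.sum_fiberwise_of_maps_to
          (fun i _ => Finset.mem_image_of_mem _ (Finset.mem_univ i)) _).symm
    _ ≤ (Finset.univ.image p).card • ρ := Finset.sum_le_card_nsmul _ _ _ fun b _ => hw _ (hp b)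
    _ = ρ * binOpt σ := by rw [← hpopt, nsmul_eq_mul, mul_comm, numBins]

theorem sum_le_binOpt {σ : List ℝ} (hσ : IsInstance σ) : σ.sum ≤ binOpt σ := by
  simpa using sum_map_le_mul_binOpt hσ (w := id) (ρ := 1) fun _ hs => hs

theorem countP_le_mul_binOpt {σ : List ℝ} (hσ : IsInstance σ) (m : ℕ) {q : ℝ → Bool}
    (hq : ∀ x, q x → 1 / ((m : ℝ) + 1) < x) : (σ.countP q : ℝ) ≤ m * binOpt σ := by
  have hcount : (σ.countP q : ℝ) = (σ.map fun x => if q x then (1 : ℝ) else 0).sum := by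
    simp [List.sum_map_ite, List.countP_eq_length_filter]
  rw [hcount]
  refine sum_map_le_mul_binOpt hσ fun s hs => ?_
  rw [← Finset.sum_filter, Finset.sum_const, nsmul_one]
  set u := s.filter fun i => q (σ.get i)
  rcases u.eq_empty_or_nonempty with hu | hu
  · simp [hu]
  have hlt : (u.card : ℝ) / (m + 1) < 1 :=
    calc (u.card : ℝ) / (m + 1)
        = ∑ _i ∈ u, 1 / ((m : ℝ) + 1) := by rw [Finset.sum_const, nsmul_eq_mul, mul_one_div]
      _ < ∑ i ∈ u, σ.get i :=
          Finset.sum_lt_sum_of_nonempty hu fun i hi => hq _ (Finset.mem_filter.1 hi).2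
      _ ≤ ∑ i ∈ s, σ.get i := Finset.sum_le_sum_of_subset_of_nonneg (Finset.filter_subset _ _)
          fun i _ _ => (hσ _ (List.get_mem _ _)).1.le
      _ ≤ 1 := hs
  rw [div_lt_one (by positivity)] at hlt
  exact_mod_cast Nat.lt_succ_iff.1 (by exact_mod_cast hlt)

theorem OnlineAlg.TrustedRatioLE.mono {A : OnlineAlg} {r r' : ℝ} (h : A.TrustedRatioLE r)
    (hr : r ≤ r') : A.TrustedRatioLE r' := by
  obtain ⟨d, hd⟩ := h
  refine ⟨d, fun σ hσ => ?_⟩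
  obtain ⟨φ, hφ⟩ := hd σ hσ
  exact ⟨φ, hφ.trans (by gcongr)⟩

theorem OnlineAlg.UntrustedRatioLE.mono {A : OnlineAlg} {w w' : ℝ} (h : A.UntrustedRatioLE w)
    (hw : w ≤ w') : A.UntrustedRatioLE w' := by
  obtain ⟨d, hd⟩ := h
  exact ⟨d, fun σ hσ φ => (hd σ hσ φ).trans (by gcongr)⟩

namespace RRC

/-- Number of large items, of size in `(2/3, 1]`. -/
noncomputable def numLarge (σ : List ℝ) : ℕ := σ.countP fun x => 2 / 3 < x

/-- Number of critical items, of size in `(1/2, 2/3]`. -/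
noncomputable def numCritical (σ : List ℝ) : ℕ := σ.countP fun x => 1 / 2 < x ∧ x ≤ 2 / 3

/-- Number of small items, of size in `(1/3, 1/2]`. -/
noncomputable def numSmall (σ : List ℝ) : ℕ := σ.countP fun x => 1 / 3 < x ∧ x ≤ 1 / 2

open scoped Classical in
/-- Total size of the tiny items, of size at most `1/3`. -/
noncomputable def tinyVolume (σ : List ℝ) : ℝ := (σ.filter fun x => x ≤ 1 / 3).sum

theorem tinyVolume_cons (x : ℝ) (σ : List ℝ) :
    tinyVolume (x :: σ) = (if x ≤ 1 / 3 then x else 0) + tinyVolume σ := by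
  by_cases hx : x ≤ 1 / 3 <;> simp only [tinyVolume, List.filter_cons, hx] <;> simp

theorem tinyVolume_append (σ τ : List ℝ) :
    tinyVolume (σ ++ τ) = tinyVolume σ + tinyVolume τ := by
  simp [tinyVolume]

theorem tinyVolume_singleton_of_le {x : ℝ} (hx : x ≤ 1 / 3) : tinyVolume [x] = x := by
  rw [tinyVolume_cons, if_pos hx]
  simp [tinyVolume]

theorem tinyVolume_singleton_of_lt {x : ℝ} (hx : 1 / 3 < x) : tinyVolume [x] = 0 := by
  rw [tinyVolume_cons, if_neg hx.not_ge]
  simp [tinyVolume]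

theorem tinyVolume_nonneg {σ : List ℝ} (hσ : ∀ x ∈ σ, 0 < x) : 0 ≤ tinyVolume σ :=
  List.sum_nonneg fun x hx => (hσ x (List.mem_of_mem_filter hx)).le

theorem tinyVolume_perm {σ τ : List ℝ} (h : σ.Perm τ) : tinyVolume σ = tinyVolume τ :=
  (h.filter _).sum_eq

theorem volume_le_sum (σ : List ℝ) :
    2 / 3 * numLarge σ + 1 / 2 * numCritical σ + 1 / 3 * numSmall σ + tinyVolume σ ≤ σ.sum := by
  induction σ with
  | nil => simp [numLarge, numCritical, numSmall, tinyVolume]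
  | cons x σ ih =>
    rw [tinyVolume_cons]
    simp only [numLarge, numCritical, numSmall, List.countP_cons, List.sum_cons,
      decide_eq_true_eq] at ih ⊢
    push_cast
    split_ifs <;> grind

theorem volume_le_binOpt {σ : List ℝ} (hσ : IsInstance σ) :
    2 / 3 * (numLarge σ : ℝ) + 1 / 2 * numCritical σ + 1 / 3 * numSmall σ + tinyVolume σ ≤
      binOpt σ :=
  (volume_le_sum σ).trans (sum_le_binOpt hσ)

theorem numLarge_add_numCritical (σ : List ℝ) :
    numLarge σ + numCritical σ = σ.countP fun x => 1 / 2 < x := by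
  induction σ with
  | nil => simp [numLarge, numCritical]
  | cons x σ ih =>
    simp only [numLarge, numCritical, List.countP_cons, decide_eq_true_eq] at ih ⊢
    split_ifs <;> grind

theorem numLarge_add_numCritical_add_numSmall (σ : List ℝ) :
    numLarge σ + numCritical σ + numSmall σ = σ.countP fun x => 1 / 3 < x := by
  rw [numLarge_add_numCritical]
  induction σ with
  | nil => simp [numSmall]
  | cons x σ ih =>
    simp only [numSmall, List.countP_cons, decide_eq_true_eq] at ih ⊢
    split_ifs <;> grind

theorem numLarge_add_numCritical_le_binOpt {σ : List ℝ} (hσ : IsInstance σ) :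
    (numLarge σ : ℝ) + numCritical σ ≤ binOpt σ := by
  rw [← Nat.cast_add, numLarge_add_numCritical]
  simpa using countP_le_mul_binOpt hσ 1 (q := fun x => 1 / 2 < x) fun x hx => by
    norm_num at hx ⊢
    exact hx

theorem numLarge_add_numCritical_add_numSmall_le {σ : List ℝ} (hσ : IsInstance σ) :
    (numLarge σ : ℝ) + numCritical σ + numSmall σ ≤ 2 * binOpt σ := by
  rw [← Nat.cast_add, ← Nat.cast_add, numLarge_add_numCritical_add_numSmall]
  simpa using countP_le_mul_binOpt hσ 2 (q := fun x => 1 / 3 < x) fun x hx => by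
    norm_num at hx ⊢
    exact hx

/-- The bin `b` with the item `x` added. -/
def Bin.insert (b : Bin) (x : ℝ) : Bin := ⟨b.kind, b.items ++ [x]⟩

/-- The rule, depending on the kind of `b`, under which the algorithm may put `x` into `b`. It folds
the case distinction of `place` on the class of `x` into a single predicate. -/
def Bin.Accepts (b : Bin) (x : ℝ) : Prop :=
  match b.kind with
  | .tiny => x ≤ 1 / 3 ∧ b.level + x ≤ 1
  | .small => (1 / 3 < x ∧ x ≤ 1 / 2) ∧ b.items.length < 2
  | .critical =>
      (x ≤ 1 / 3 ∧ b.tinyLevel + x ≤ 1 / 3) ∨ ((1 / 2 < x ∧ x ≤ 2 / 3) ∧ ¬ b.HasCritical)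
  | .large => False

namespace Bin

variable {b : Bin} {x : ℝ}

theorem accepts_tiny_iff (hb : b.kind = .tiny) : b.Accepts x ↔ x ≤ 1 / 3 ∧ b.level + x ≤ 1 := by
  simp only [Accepts, hb]

theorem accepts_small_iff (hb : b.kind = .small) :
    b.Accepts x ↔ (1 / 3 < x ∧ x ≤ 1 / 2) ∧ b.items.length < 2 := by
  simp only [Accepts, hb]

theorem accepts_critical_iff (hb : b.kind = .critical) :
    b.Accepts x ↔
      (x ≤ 1 / 3 ∧ b.tinyLevel + x ≤ 1 / 3) ∨ ((1 / 2 < x ∧ x ≤ 2 / 3) ∧ ¬ b.HasCritical) := by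
  simp only [Accepts, hb]

theorem not_accepts_large (hb : b.kind = .large) : ¬ b.Accepts x := by
  simp only [Accepts, hb, not_false_eq_true]

theorem not_accepts_of_large (hx : 2 / 3 < x) : ¬ b.Accepts x := by
  cases hb : b.kind <;> simp only [Accepts, hb] <;> grind

theorem accepts_iff_of_critical (b : Bin) (hx : 1 / 2 < x) (hx' : x ≤ 2 / 3) :
    b.Accepts x ↔ b.kind = .critical ∧ ¬ b.HasCritical := by
  cases hb : b.kind <;> simp only [Accepts, hb] <;> grind

theorem accepts_iff_of_small (b : Bin) (hx : 1 / 3 < x) (hx' : x ≤ 1 / 2) :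
    b.Accepts x ↔ b.kind = .small ∧ b.items.length < 2 := by
  cases hb : b.kind <;> simp only [Accepts, hb] <;> grind

theorem accepts_iff_of_tiny (b : Bin) (hx : x ≤ 1 / 3) :
    b.Accepts x ↔ b.kind = .critical ∧ b.tinyLevel + x ≤ 1 / 3 ∨
      b.kind = .tiny ∧ b.level + x ≤ 1 := by
  cases hb : b.kind <;> simp only [Accepts, hb] <;> grind

theorem level_insert (b : Bin) (x : ℝ) : (b.insert x).level = b.level + x := by
  simp [level, insert]

theorem tinyLevel_insert (b : Bin) (x : ℝ) :
    (b.insert x).tinyLevel = b.tinyLevel + tinyVolume [x] :=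
  tinyVolume_append _ _

theorem tinyLevel_insert_of_le (b : Bin) (hx : x ≤ 1 / 3) :
    (b.insert x).tinyLevel = b.tinyLevel + x := by
  rw [tinyLevel_insert, tinyVolume_singleton_of_le hx]

theorem tinyLevel_insert_of_lt (b : Bin) (hx : 1 / 3 < x) :
    (b.insert x).tinyLevel = b.tinyLevel := by
  rw [tinyLevel_insert, tinyVolume_singleton_of_lt hx, add_zero]

end Bin

theorem firstIdx_lt_length_iff {L : List Bin} {P : Bin → Prop} :
    firstIdx L P < L.length ↔ ∃ b ∈ L, P b := by
  classical
  simp only [firstIdx, List.findIdx_lt_length, decide_eq_true_eq]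

theorem firstIdx_le_length (L : List Bin) (P : Bin → Prop) : firstIdx L P ≤ L.length :=
  List.findIdx_le_length

theorem eq_append_cons_of_firstIdx_lt_length {L : List Bin} {P : Bin → Prop}
    (h : firstIdx L P < L.length) :
    ∃ L₁ b L₂, L = L₁ ++ b :: L₂ ∧ L₁.length = firstIdx L P ∧ P b ∧ ∀ a ∈ L₁, ¬ P a := by
  classical
  refine ⟨L.take (firstIdx L P), L[firstIdx L P], L.drop (firstIdx L P + 1), ?_, ?_, ?_, ?_⟩
  · rw [List.getElem_cons_drop, List.take_append_drop]
  · exact List.length_take_of_le h.le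
  · exact of_decide_eq_true (List.findIdx_getElem (w := h))
  · intro a ha
    obtain ⟨i, hi, rfl⟩ := List.getElem_of_mem ha
    rw [List.length_take] at hi
    rw [List.getElem_take]
    have := List.not_of_lt_findIdx (xs := L) (p := fun b => decide (P b)) (lt_min_iff.1 hi).1
    simpa using this

theorem place_eq_firstIdx (L : List Bin) (x : ℝ) :
    ∃ κ, place L x = firstIdx L (fun b => b.kind = κ ∧ b.Accepts x) ∧
      ∀ b ∈ L, b.Accepts x → ∃ a ∈ L, a.kind = κ ∧ a.Accepts x := by
  by_cases hlarge : 2 / 3 < x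
  · have hnone : ¬ ∃ b ∈ L, b.kind = .large ∧ b.Accepts x :=
      fun ⟨_, _, _, hb⟩ => Bin.not_accepts_of_large hlarge hb
    refine ⟨.large, ?_, fun b _ hb => absurd hb (Bin.not_accepts_of_large hlarge)⟩
    rw [place, if_pos hlarge]
    exact ((firstIdx_le_length L _).eq_of_not_lt (firstIdx_lt_length_iff.not.2 hnone)).symm
  by_cases hcrit : 1 / 2 < x
  · have hiff (b : Bin) := b.accepts_iff_of_critical hcrit (not_lt.1 hlarge)
    refine ⟨.critical, ?_, fun b hb hbx => ⟨b, hb, ((hiff b).1 hbx).1, hbx⟩⟩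
    rw [place, if_neg hlarge, if_pos hcrit]
    grind
  by_cases hsmall : 1 / 3 < x
  · have hiff (b : Bin) := b.accepts_iff_of_small hsmall (not_lt.1 hcrit)
    refine ⟨.small, ?_, fun b hb hbx => ⟨b, hb, ((hiff b).1 hbx).1, hbx⟩⟩
    rw [place, if_neg hlarge, if_neg hcrit, if_pos hsmall]
    simp only [hiff, and_self_left]
  have hiff (b : Bin) := b.accepts_iff_of_tiny (not_lt.1 hsmall)
  rw [place, if_neg hlarge, if_neg hcrit, if_neg hsmall]
  by_cases htiny : ∃ b ∈ L, b.kind = Kind.critical ∧ b.tinyLevel + x ≤ 1 / 3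
  · obtain ⟨a, ha, hax⟩ := id htiny
    refine ⟨.critical, ?_, fun _ _ _ => ⟨a, ha, hax.1, (hiff a).2 (.inl hax)⟩⟩
    rw [if_pos htiny]
    congr! 2 with b
    grind
  · refine ⟨.tiny, ?_, fun b hb hbx => ⟨b, hb, ?_, hbx⟩⟩
    · rw [if_neg htiny]
      congr! 2 with b
      grind
    · exact (((hiff b).1 hbx).resolve_left fun h => htiny ⟨b, hb, h⟩).1

/-- `Serve β x L L'`: the bins `L` become `L'` when `x` is served, either because `x` joins a bin
that accepts it, no earlier bin of that kind doing so, or because no bin accepts `x` and a new one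
is opened. -/
inductive Serve (β x : ℝ) : List Bin → List Bin → Prop
  | insert {L₁ L₂ : List Bin} {b : Bin} (hb : b.Accepts x)
      (hfirst : ∀ a ∈ L₁, a.kind = b.kind → ¬ a.Accepts x) :
      Serve β x (L₁ ++ b :: L₂) (L₁ ++ b.insert x :: L₂)
  | openBin {L : List Bin} (hL : ∀ b ∈ L, ¬ b.Accepts x) :
      Serve β x L (L ++ [⟨newKind β L x, [x]⟩])

theorem serve_step (β : ℝ) (L : List Bin) (x : ℝ) : Serve β x L (step β L x) := by
  obtain ⟨κ, hplace, hκ⟩ := place_eq_firstIdx L x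
  rcases lt_or_ge (place L x) L.length with hlt | hge
  · rw [step, if_pos hlt]
    rw [hplace] at hlt ⊢
    obtain ⟨L₁, b, L₂, hL, hlen, ⟨hbκ, hb⟩, hfirst⟩ := eq_append_cons_of_firstIdx_lt_length hlt
    have hmodify (f : Bin → Bin) : (L₁ ++ b :: L₂).modify L₁.length f = L₁ ++ f b :: L₂ := by
      simp [List.modify_eq_take_cons_drop]
    rw [← hlen, hL, hmodify]
    exact .insert hb fun a ha hab hax => hfirst a ha ⟨hab.trans hbκ, hax⟩
  · rw [step, if_neg hge.not_gt]
    refine .openBin fun b hb hbx => hge.not_gt ?_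
    rw [hplace, firstIdx_lt_length_iff]
    exact hκ b hb hbx

section NewKind

variable {β x : ℝ} {L : List Bin}

theorem newKind_eq_tiny_iff : newKind β L x = .tiny ↔ x ≤ 1 / 3 ∧
    β ≤ (countKind L .critical : ℝ) / (countKind L .critical + countKind L .tiny) := by
  grind [newKind]

theorem newKind_eq_critical_iff : newKind β L x = .critical ↔ 1 / 2 < x ∧ x ≤ 2 / 3 ∨
    x ≤ 1 / 3 ∧
      (countKind L .critical : ℝ) / (countKind L .critical + countKind L .tiny) < β := by
  grind [newKind]

end NewKind

/-- The invariant of a single bin: its contents match its kind and fit. -/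
structure Bin.Valid (b : Bin) : Prop where
  items_ne_nil : b.items ≠ []
  pos : ∀ y ∈ b.items, 0 < y
  level_le_one : b.level ≤ 1
  tiny : b.kind = .tiny → ∀ y ∈ b.items, y ≤ 1 / 3
  small : b.kind = .small → ∀ y ∈ b.items, 1 / 3 < y ∧ y ≤ 1 / 2
  critical : b.kind = .critical → (∀ y ∈ b.items, y ≤ 1 / 3 ∨ 1 / 2 < y ∧ y ≤ 2 / 3) ∧
    b.tinyLevel ≤ 1 / 3 ∧ b.level ≤ b.tinyLevel + 2 / 3
  large : b.kind = .large → ∃ y ∈ b.items, 2 / 3 < y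

namespace Bin

variable {b : Bin} {x : ℝ}

theorem Valid.tinyLevel_nonneg (hb : b.Valid) : 0 ≤ b.tinyLevel := tinyVolume_nonneg hb.pos

theorem Valid.le_tinyLevel (hb : b.Valid) (hx : x ∈ b.items) (hx' : x ≤ 1 / 3) :
    x ≤ b.tinyLevel :=
  List.single_le_sum (fun y hy => (hb.pos y (List.mem_of_mem_filter hy)).le) x
    (List.mem_filter.2 ⟨hx, by simpa using hx'⟩)

theorem tinyLevel_eq_level (hb : ∀ y ∈ b.items, y ≤ 1 / 3) : b.tinyLevel = b.level := by
  rw [tinyLevel, level, List.filter_eq_self.2 (by simpa using hb)]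

theorem Valid.level_le_insert_of_critical (hb : b.Valid) (hk : b.kind = .critical)
    (hbx : b.Accepts x) :
    (b.insert x).tinyLevel ≤ 1 / 3 ∧ (b.insert x).level ≤ (b.insert x).tinyLevel + 2 / 3 := by
  obtain ⟨hitems, htiny, hlevel⟩ := hb.critical hk
  rw [level_insert]
  rcases (accepts_critical_iff hk).1 hbx with ⟨hx, hfits⟩ | ⟨hx, hvacant⟩
  · rw [tinyLevel_insert_of_le b hx]
    exact ⟨hfits, by linarith⟩
  · have hall : b.tinyLevel = b.level := tinyLevel_eq_level fun y hy =>
      (hitems y hy).resolve_right fun h => hvacant ⟨y, hy, h.1⟩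
    rw [tinyLevel_insert_of_lt b (by linarith)]
    exact ⟨htiny, by linarith⟩

theorem Valid.level_insert_le_one (hb : b.Valid) (hbx : b.Accepts x) :
    (b.insert x).level ≤ 1 := by
  cases hk : b.kind
  case tiny => exact (level_insert b x).trans_le ((accepts_tiny_iff hk).1 hbx).2
  case small =>
    obtain ⟨hx, hlen⟩ := (accepts_small_iff hk).1 hbx
    have hlevel : b.level ≤ b.items.length • (1 / 2 : ℝ) :=
      List.sum_le_card_nsmul _ _ fun y hy => (hb.small hk y hy).2
    have hlen' : (b.items.length : ℝ) ≤ 1 := by exact_mod_cast Nat.le_of_lt_succ hlen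
    rw [nsmul_eq_mul] at hlevel
    rw [level_insert]
    linarith
  case critical => linarith [hb.level_le_insert_of_critical hk hbx]
  case large => exact absurd hbx (not_accepts_large hk)

theorem Valid.insert (hb : b.Valid) (hx : 0 < x) (hbx : b.Accepts x) : (b.insert x).Valid where
  items_ne_nil := by simp [Bin.insert]
  pos := by simpa [Bin.insert, or_imp, forall_and] using ⟨hb.pos, hx⟩
  level_le_one := hb.level_insert_le_one hbx
  tiny hk := by
    have := hb.tiny hk
    have := (accepts_tiny_iff (b := b) hk).1 hbx
    grind [Bin.insert]
  small hk := by
    have := hb.small hk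
    have := (accepts_small_iff (b := b) hk).1 hbx
    grind [Bin.insert]
  critical hk := by
    refine ⟨?_, hb.level_le_insert_of_critical hk hbx⟩
    have := (hb.critical hk).1
    have := (accepts_critical_iff (b := b) hk).1 hbx
    grind [Bin.insert]
  large hk := absurd hbx (not_accepts_large hk)

theorem valid_newBin (β : ℝ) (L : List Bin) (hx₀ : 0 < x) (hx₁ : x ≤ 1) :
    Bin.Valid ⟨newKind β L x, [x]⟩ := by
  have htiny : tinyVolume [x] = if x ≤ 1 / 3 then x else 0 := by
    split_ifs with h
    · exact tinyVolume_singleton_of_le h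
    · exact tinyVolume_singleton_of_lt (not_le.1 h)
  have hlevel : Bin.tinyLevel ⟨newKind β L x, [x]⟩ = if x ≤ 1 / 3 then x else 0 := htiny
  constructor <;>
    simp only [hlevel, Bin.level, List.mem_singleton, List.sum_singleton, forall_eq,
      exists_eq_left]
  all_goals grind [newKind]

/-- The First-Fit relation between a bin and a later one: no item of the later bin would be accepted
by the earlier bin of the same kind. -/
def FirstFit (a b : Bin) : Prop := a.kind = b.kind → ∀ y ∈ b.items, ¬ a.Accepts y

theorem Accepts.of_insert {y : ℝ} (hx : 0 < x) (h : (b.insert x).Accepts y) : b.Accepts y := by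
  have htiny : b.tinyLevel ≤ (b.insert x).tinyLevel := by
    rw [tinyLevel_insert]
    linarith [tinyVolume_nonneg (σ := [x]) (by simpa using hx)]
  have hvacant (h : ¬ (b.insert x).HasCritical) : ¬ b.HasCritical :=
    fun ⟨z, hz, hz'⟩ => h ⟨z, List.mem_append_left _ hz, hz'⟩
  cases hk : b.kind
  case tiny =>
    rw [accepts_tiny_iff hk]
    rw [accepts_tiny_iff (b := b.insert x) hk, level_insert] at h
    exact ⟨h.1, by linarith⟩
  case small =>
    rw [accepts_small_iff hk]
    rw [accepts_small_iff (b := b.insert x) hk] at h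
    exact ⟨h.1, lt_of_le_of_lt (by simp [Bin.insert]) h.2⟩
  case critical =>
    rw [accepts_critical_iff hk]
    rw [accepts_critical_iff (b := b.insert x) hk] at h
    exact h.imp (fun h => ⟨h.1, by linarith⟩) fun h => ⟨h.1, hvacant h.2⟩
  case large => exact absurd h (not_accepts_large (b := b.insert x) hk)

end Bin

theorem run_append_singleton (β : ℝ) (σ : List ℝ) (x : ℝ) :
    run β (σ ++ [x]) = step β (run β σ) x := by
  simp [run]

namespace Serve

variable {β x : ℝ} {L L' : List Bin}

theorem perm (h : Serve β x L L') :
    (L'.flatMap Bin.items).Perm (L.flatMap Bin.items ++ [x]) := by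
  cases h with
  | @insert L₁ L₂ b =>
    simp only [Bin.insert, List.flatMap_append, List.flatMap_cons, List.append_assoc]
    exact ((List.perm_append_comm.append_left _).append_left _)
  | openBin => simp

theorem valid (h : Serve β x L L') (hx₀ : 0 < x) (hx₁ : x ≤ 1) (hL : ∀ b ∈ L, b.Valid) :
    ∀ b ∈ L', b.Valid := by
  cases h with
  | @insert L₁ L₂ b hb =>
    have := (hL b (by simp)).insert hx₀ hb
    grind
  | openBin =>
    have := Bin.valid_newBin β L hx₀ hx₁
    grind

theorem pairwise_firstFit (h : Serve β x L L') (hx : 0 < x) (hL : L.Pairwise Bin.FirstFit) :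
    L'.Pairwise Bin.FirstFit := by
  cases h with
  | @insert L₁ L₂ b hb hfirst =>
    rw [List.pairwise_append, List.pairwise_cons] at hL ⊢
    obtain ⟨hL₁, ⟨hbL₂, hL₂⟩, hcross⟩ := hL
    refine ⟨hL₁, ⟨fun c hc hk y hy hacc => hbL₂ c hc hk y hy (hacc.of_insert hx), hL₂⟩, ?_⟩
    intro a ha c hc
    rcases List.mem_cons.1 hc with rfl | hc
    · intro hk y hy
      rcases List.mem_append.1 hy with hy | hy
      · exact hcross a ha b List.mem_cons_self hk y hy
      · exact List.mem_singleton.1 hy ▸ hfirst a ha hk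
    · exact hcross a ha c (List.mem_cons_of_mem _ hc)
  | openBin hnone =>
    refine List.pairwise_append.2 ⟨hL, List.pairwise_singleton _ _, fun a ha c hc => ?_⟩
    rw [List.mem_singleton.1 hc]
    exact fun _ y hy => List.mem_singleton.1 hy ▸ hnone a ha

end Serve

theorem perm_run (β : ℝ) (σ : List ℝ) : ((run β σ).flatMap Bin.items).Perm σ := by
  induction σ using List.reverseRecOn with
  | nil => exact .nil
  | append_singleton σ x ih =>
    rw [run_append_singleton]
    exact (serve_step β _ x).perm.trans (ih.append_right [x])

theorem valid_run (β : ℝ) {σ : List ℝ} (hσ : IsInstance σ) : ∀ b ∈ run β σ, b.Valid := by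
  induction σ using List.reverseRecOn with
  | nil => simp [run]
  | append_singleton σ x ih =>
    obtain ⟨hx₀, hx₁⟩ := hσ x (by simp)
    rw [run_append_singleton]
    exact (serve_step β _ x).valid hx₀ hx₁ (ih fun y hy => hσ y (List.mem_append_left _ hy))

theorem pairwise_firstFit_run (β : ℝ) {σ : List ℝ} (hσ : IsInstance σ) :
    (run β σ).Pairwise Bin.FirstFit := by
  induction σ using List.reverseRecOn with
  | nil => exact .nil
  | append_singleton σ x ih =>
    rw [run_append_singleton]
    exact (serve_step β _ x).pairwise_firstFit (hσ x (by simp)).1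
      (ih fun y hy => hσ y (List.mem_append_left _ hy))

open scoped Classical in
/-- The sum of `f` over the bins of kind `κ`; the instance `f = Bin.tinyLevel` measures how much of
the tiny items sits in the critical, respectively tiny, bins. -/
noncomputable def kindSum (f : Bin → ℝ) (κ : Kind) (L : List Bin) : ℝ :=
  ((L.filter fun b => b.kind = κ).map f).sum

theorem mul_length_sub_one_le_sum {v : ℝ} (hv : 0 ≤ v) {l : List ℝ} (hl : ∀ x ∈ l, 0 ≤ x)
    (h : l.Pairwise fun x y => v ≤ x ∨ v ≤ y) : v * ((l.length : ℝ) - 1) ≤ l.sum := by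
  induction l with
  | nil => simpa using hv
  | cons a l ih =>
    rw [List.pairwise_cons] at h
    have ha : 0 ≤ a := hl a List.mem_cons_self
    rw [List.sum_cons, List.length_cons, Nat.cast_succ, add_sub_cancel_right]
    by_cases hva : v ≤ a
    · linarith [ih (fun x hx => hl x (List.mem_cons_of_mem a hx)) h.2]
    · have hsum := List.card_nsmul_le_sum l v fun x hx => (h.1 x hx).resolve_left hva
      rw [nsmul_eq_mul] at hsum
      linarith

section KindSum

variable {f : Bin → ℝ} {κ κ' : Kind} {L : List Bin} {v : ℝ}

theorem mul_countKind_sub_one_le_kindSum (hv : 0 ≤ v) (hf : ∀ b ∈ L, 0 ≤ f b)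
    (h : L.Pairwise fun a b => a.kind = κ → b.kind = κ → v ≤ f a ∨ v ≤ f b) :
    v * ((countKind L κ : ℝ) - 1) ≤ kindSum f κ L := by
  classical
  have hlen : countKind L κ = ((L.filter fun b => b.kind = κ).map f).length := by
    rw [List.length_map, countKind, List.countP_eq_length_filter]
  rw [hlen]
  refine mul_length_sub_one_le_sum hv
    (List.forall_mem_map.2 fun b hb => hf b (List.mem_of_mem_filter hb)) ?_
  rw [List.pairwise_map, List.pairwise_filter]
  exact h.imp fun hab ha hb => hab (by simpa using ha) (by simpa using hb)

theorem countKind_append (κ : Kind) (L L' : List Bin) :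
    countKind (L ++ L') κ = countKind L κ + countKind L' κ :=
  List.countP_append

theorem countKind_cons (κ : Kind) (b : Bin) (L : List Bin) [Decidable (b.kind = κ)] :
    countKind (b :: L) κ = countKind L κ + if b.kind = κ then 1 else 0 := by
  by_cases hb : b.kind = κ <;> simp [countKind, hb]

theorem kindSum_append (f : Bin → ℝ) (κ : Kind) (L L' : List Bin) :
    kindSum f κ (L ++ L') = kindSum f κ L + kindSum f κ L' := by
  simp [kindSum]

theorem kindSum_cons (f : Bin → ℝ) (κ : Kind) (b : Bin) (L : List Bin) [Decidable (b.kind = κ)] :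
    kindSum f κ (b :: L) = (if b.kind = κ then f b else 0) + kindSum f κ L := by
  by_cases hb : b.kind = κ <;> simp [kindSum, hb]

theorem kindSum_nonneg (hf : ∀ b ∈ L, 0 ≤ f b) : 0 ≤ kindSum f κ L :=
  List.sum_nonneg (List.forall_mem_map.2 fun b hb => hf b (List.mem_of_mem_filter hb))

theorem kindSum_add_kindSum_le_sum (hκ : κ ≠ κ') (hf : ∀ b ∈ L, 0 ≤ f b) :
    kindSum f κ L + kindSum f κ' L ≤ (L.map f).sum := by
  classical
  induction L with
  | nil => simp [kindSum]
  | cons b L ih =>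
    have hb : 0 ≤ f b := hf b List.mem_cons_self
    have := ih fun c hc => hf c (List.mem_cons_of_mem b hc)
    rw [kindSum_cons, kindSum_cons, List.map_cons, List.sum_cons]
    split_ifs <;> grind

theorem length_eq_sum_countKind (L : List Bin) :
    L.length =
      countKind L .large + countKind L .small + countKind L .critical + countKind L .tiny := by
  induction L with
  | nil => rfl
  | cons b L ih =>
    classical
    rw [List.length_cons, ih]
    simp only [countKind_cons]
    cases b.kind <;> grind

theorem countKind_le_countP {q : ℝ → Bool} (h : ∀ b ∈ L, b.kind = κ → ∃ y ∈ b.items, q y) :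
    countKind L κ ≤ (L.flatMap Bin.items).countP q := by
  induction L with
  | nil => simp [countKind]
  | cons b L ih =>
    classical
    have hL := ih fun c hc => h c (List.mem_cons_of_mem b hc)
    rw [countKind_cons, List.flatMap_cons, List.countP_append]
    split_ifs with hb
    · have := List.countP_pos_iff.2 (h b List.mem_cons_self hb)
      omega
    · omega

end KindSum

theorem tinyVolume_flatMap (L : List Bin) :
    tinyVolume (L.flatMap Bin.items) = (L.map Bin.tinyLevel).sum := by
  induction L with
  | nil => simp [tinyVolume]
  | cons b L ih =>
    rw [List.flatMap_cons, tinyVolume_append, ih, List.map_cons, List.sum_cons]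
    rfl

section Counting

variable {L : List Bin}

theorem countKind_large_le_numLarge (hL : ∀ b ∈ L, b.Valid) :
    countKind L .large ≤ numLarge (L.flatMap Bin.items) :=
  countKind_le_countP fun b hb hk => by simpa using (hL b hb).large hk

theorem countKind_critical_le_numCritical (hL : ∀ b ∈ L, b.Valid)
    (hcrit : ∀ b ∈ L, b.kind = .critical → b.HasCritical) :
    countKind L .critical ≤ numCritical (L.flatMap Bin.items) := by
  refine countKind_le_countP fun b hb hk => ?_
  obtain ⟨y, hy, hlt⟩ := hcrit b hb hk
  exact ⟨y, hy, by grind [((hL b hb).critical hk).1 y hy]⟩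

theorem two_mul_countKind_small_sub_one_le_numSmall (hL : ∀ b ∈ L, b.Valid)
    (hff : L.Pairwise Bin.FirstFit) :
    2 * ((countKind L .small : ℝ) - 1) ≤ numSmall (L.flatMap Bin.items) := by
  have hf : ∀ b ∈ L, (0 : ℝ) ≤ numSmall b.items := fun _ _ => Nat.cast_nonneg _
  have htotal : (L.map fun b => (numSmall b.items : ℝ)).sum = numSmall (L.flatMap Bin.items) := by
    rw [numSmall, List.countP_flatMap, Nat.cast_list_sum, List.map_map]
    rfl
  have hcount : ∀ b ∈ L, b.kind = .small → numSmall b.items = b.items.length :=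
    fun b hb hk => List.countP_eq_length.2 fun y hy => by simpa using (hL b hb).small hk y hy
  have hpairs := mul_countKind_sub_one_le_kindSum (κ := .small) (v := 2) zero_le_two hf <|
    hff.imp_of_mem fun {a b} ha hb hab hka hkb => .inl <| by
      obtain ⟨y, hy⟩ := List.exists_mem_of_ne_nil _ (hL b hb).items_ne_nil
      have hrej := hab (hka.trans hkb.symm) y hy
      rw [Bin.accepts_small_iff hka, not_and, not_lt] at hrej
      rw [hcount a ha hka]
      exact_mod_cast hrej ((hL b hb).small hkb y hy)
  linarith [kindSum_add_kindSum_le_sum (κ := .small) (κ' := .tiny) (by simp) hf,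
    kindSum_nonneg (κ := .tiny) hf]

theorem mul_countKind_tiny_sub_one_le_kindSum (hL : ∀ b ∈ L, b.Valid)
    (hff : L.Pairwise Bin.FirstFit) :
    2 / 3 * ((countKind L .tiny : ℝ) - 1) ≤ kindSum Bin.tinyLevel .tiny L := by
  refine mul_countKind_sub_one_le_kindSum (by norm_num)
    (fun b hb => (hL b hb).tinyLevel_nonneg) ?_
  refine hff.imp_of_mem fun {a b} ha hb hab hka hkb => .inl ?_
  obtain ⟨y, hy⟩ := List.exists_mem_of_ne_nil _ (hL b hb).items_ne_nil
  have hytiny := (hL b hb).tiny hkb y hy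
  have hrej := hab (hka.trans hkb.symm) y hy
  rw [Bin.accepts_tiny_iff hka, not_and, not_le] at hrej
  rw [Bin.tinyLevel_eq_level ((hL a ha).tiny hka)]
  linarith [hrej hytiny]

theorem mul_countKind_critical_sub_one_le_kindSum (hL : ∀ b ∈ L, b.Valid)
    (hff : L.Pairwise Bin.FirstFit)
    (htiny : ∀ b ∈ L, b.kind = .critical → ∃ y ∈ b.items, y ≤ 1 / 3) :
    1 / 6 * ((countKind L .critical : ℝ) - 1) ≤ kindSum Bin.tinyLevel .critical L := by
  refine mul_countKind_sub_one_le_kindSum (by norm_num)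
    (fun b hb => (hL b hb).tinyLevel_nonneg) ?_
  refine hff.imp_of_mem fun {a b} _ hb hab hka hkb => ?_
  obtain ⟨y, hy, hytiny⟩ := htiny b hb hkb
  have hrej : 1 / 3 < a.tinyLevel + y := by
    have := hab (hka.trans hkb.symm) y hy
    grind [Bin.accepts_critical_iff]
  have hyb : y ≤ b.tinyLevel := (hL b hb).le_tinyLevel hy hytiny
  by_contra! hlt
  linarith

theorem kindSum_critical_add_kindSum_tiny_le_tinyVolume (hL : ∀ b ∈ L, b.Valid) :
    kindSum Bin.tinyLevel .critical L + kindSum Bin.tinyLevel .tiny L ≤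
      tinyVolume (L.flatMap Bin.items) := by
  rw [tinyVolume_flatMap]
  exact kindSum_add_kindSum_le_sum (by simp) fun b hb => (hL b hb).tinyLevel_nonneg

end Counting

/-- What the last opening of a tiny bin leaves behind. At that moment there were `c` critical bins,
they made up at least a fraction `β` of the critical and tiny bins, and none of them could take
the arriving tiny item, so that they were filled to `1/6` on average, up to one bin. -/
def LastTinyOpening (β : ℝ) (L : List Bin) : Prop :=
  countKind L .tiny = 0 ∨ ∃ c : ℕ, c ≤ countKind L .critical ∧
    β * (c + countKind L .tiny - 1) ≤ c ∧ 1 / 6 * ((c : ℝ) - 1) ≤ kindSum Bin.tinyLevel .critical L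

/-- What the last opening of a critical bin leaves behind. Unless every critical bin has a critical
item, the last critical bin was opened for a tiny item, when the critical bins made up less than
a fraction `β` of the critical and tiny bins and none of them could take that item. -/
def LastCriticalOpening (β : ℝ) (L : List Bin) : Prop :=
  (∀ b ∈ L, b.kind = .critical → b.HasCritical) ∨
    0 < β ∧ countKind L .critical ≤ β * (countKind L .critical + countKind L .tiny) + 1 ∧
      1 / 6 * ((countKind L .critical : ℝ) - 1) ≤ kindSum Bin.tinyLevel .critical L

theorem Bin.exists_tiny_of_not_accepts {b : Bin} {x : ℝ} (hb : b.kind = .critical) (hx : x ≤ 1 / 3)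
    (hbx : ¬ b.Accepts x) : ∃ y ∈ b.items, y ≤ 1 / 3 := by
  by_contra! hnone
  have hzero : b.tinyLevel = 0 := by
    rw [tinyLevel, List.filter_eq_nil_iff.2 (by simpa using hnone), List.sum_nil]
  exact hbx ((accepts_critical_iff hb).2 (.inl ⟨hx, by linarith⟩))

theorem countKind_insert (κ : Kind) (L₁ L₂ : List Bin) (b : Bin) (x : ℝ) :
    countKind (L₁ ++ b.insert x :: L₂) κ = countKind (L₁ ++ b :: L₂) κ := by
  classical
  have : (b.insert x).kind = b.kind := rfl
  simp only [countKind_append, countKind_cons, this]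

namespace Serve

variable {β x : ℝ} {L L' : List Bin}

theorem kindSum_tinyLevel_le (h : Serve β x L L') (hx : 0 < x) (κ : Kind) :
    kindSum Bin.tinyLevel κ L ≤ kindSum Bin.tinyLevel κ L' := by
  classical
  have hx' : 0 ≤ tinyVolume [x] := tinyVolume_nonneg (by simpa using hx)
  cases h with
  | @insert L₁ L₂ b =>
    have : (b.insert x).kind = b.kind := rfl
    simp only [kindSum_append, kindSum_cons, Bin.tinyLevel_insert, this]
    split_ifs <;> linarith
  | openBin =>
    rw [kindSum_append]
    exact le_add_of_nonneg_right (kindSum_nonneg fun b hb => by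
      rw [List.mem_singleton.1 hb]
      exact hx')

theorem lastTinyOpening (h : Serve β x L L') (hx : 0 < x) (hvalid : ∀ b ∈ L, b.Valid)
    (hff : L.Pairwise Bin.FirstFit) (hL : LastTinyOpening β L) : LastTinyOpening β L' := by
  classical
  have hsum := h.kindSum_tinyLevel_le hx .critical
  have hmono (hT : countKind L' .tiny = countKind L .tiny)
      (hC : countKind L .critical ≤ countKind L' .critical) : LastTinyOpening β L' := by
    rw [LastTinyOpening, hT]
    exact hL.imp_right fun ⟨c, hc, hβ, hfull⟩ => ⟨c, hc.trans hC, hβ, hfull.trans hsum⟩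
  cases h with
  | insert => exact hmono (countKind_insert ..) (countKind_insert ..).ge
  | openBin hnone =>
    by_cases hnew : newKind β L x = .tiny
    · obtain ⟨hxtiny, hβ⟩ := newKind_eq_tiny_iff.1 hnew
      have hfull := mul_countKind_critical_sub_one_le_kindSum hvalid hff
        fun b hb hk => Bin.exists_tiny_of_not_accepts hk hxtiny (hnone b hb)
      refine .inr ⟨countKind L .critical, ?_, ?_, hfull.trans hsum⟩
      · rw [countKind_append]
        exact Nat.le_add_right _ _
      · have hT : countKind (L ++ [⟨newKind β L x, [x]⟩]) .tiny = countKind L .tiny + 1 := by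
          simp [countKind, hnew]
        rw [hT, Nat.cast_succ, ← add_assoc, add_sub_cancel_right]
        exact mul_le_of_le_div₀ (Nat.cast_nonneg _) (by positivity) hβ
    · refine hmono ?_ ?_
      · simp [countKind, hnew]
      · rw [countKind_append]
        exact Nat.le_add_right _ _

theorem lastCriticalOpening_of_newKind_eq_critical (hnone : ∀ b ∈ L, ¬ b.Accepts x)
    (hnew : newKind β L x = .critical) (hL' : L' = L ++ [⟨.critical, [x]⟩])
    (hvalid : ∀ b ∈ L', b.Valid) (hff : L'.Pairwise Bin.FirstFit) :
    LastCriticalOpening β L' := by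
  have hmem (b : Bin) : b ∈ L' ↔ b ∈ L ∨ b = ⟨.critical, [x]⟩ := by simp [hL']
  rcases newKind_eq_critical_iff.1 hnew with hx | ⟨hx, hβ⟩
  · refine .inl fun b hb hk => ?_
    rcases (hmem b).1 hb with hb | rfl
    · by_contra hvacant
      exact hnone b hb ((Bin.accepts_critical_iff hk).2 (.inr ⟨hx, hvacant⟩))
    · exact ⟨x, List.mem_singleton_self x, hx.1⟩
  · have hC : countKind L' .critical = countKind L .critical + 1 := by simp [countKind, hL']
    have hT : countKind L' .tiny = countKind L .tiny := by simp [countKind, hL']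
    have hβ₀ : 0 < β := lt_of_le_of_lt (by positivity) hβ
    refine .inr ⟨hβ₀, ?_, ?_⟩
    · rw [hC, hT, Nat.cast_succ]
      have hratio : (countKind L .critical : ℝ) ≤
          β * (countKind L .critical + countKind L .tiny) := by
        rcases eq_or_lt_of_le (show (0 : ℝ) ≤ countKind L .critical + countKind L .tiny by
          positivity) with hzero | hpos
        · rw [← hzero, mul_zero]
          linarith [Nat.cast_nonneg (α := ℝ) (countKind L .tiny)]
        · exact ((div_lt_iff₀ hpos).1 hβ).le
      linarith
    · refine mul_countKind_critical_sub_one_le_kindSum hvalid hff fun b hb hk => ?_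
      rcases (hmem b).1 hb with hb | rfl
      · exact Bin.exists_tiny_of_not_accepts hk hx (hnone b hb)
      · exact ⟨x, List.mem_singleton_self x, hx⟩

theorem lastCriticalOpening (h : Serve β x L L') (hx : 0 < x) (hvalid : ∀ b ∈ L', b.Valid)
    (hff : L'.Pairwise Bin.FirstFit) (hL : LastCriticalOpening β L) :
    LastCriticalOpening β L' := by
  classical
  have hsum := h.kindSum_tinyLevel_le hx .critical
  have hmono (hC : countKind L' .critical = countKind L .critical)
      (hT : countKind L .tiny ≤ countKind L' .tiny)
      (hcrit : (∀ b ∈ L, b.kind = .critical → b.HasCritical) →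
        ∀ b ∈ L', b.kind = .critical → b.HasCritical) : LastCriticalOpening β L' := by
    refine hL.imp hcrit fun ⟨hβ, hcount, hfull⟩ => ?_
    rw [hC]
    refine ⟨hβ, hcount.trans ?_, hfull.trans hsum⟩
    gcongr
  cases h with
  | @insert L₁ L₂ b =>
    refine hmono (countKind_insert ..) (countKind_insert ..).ge ?_
    grind [Bin.insert, Bin.HasCritical]
  | openBin hnone =>
    by_cases hnew : newKind β L x = .critical
    · exact lastCriticalOpening_of_newKind_eq_critical hnone hnew (by rw [hnew]) hvalid hff
    · refine hmono ?_ ?_ ?_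
      · simp [countKind, hnew]
      · rw [countKind_append]
        exact Nat.le_add_right _ _
      · grind

end Serve

theorem lastTinyOpening_run (β : ℝ) {σ : List ℝ} (hσ : IsInstance σ) :
    LastTinyOpening β (run β σ) := by
  induction σ using List.reverseRecOn with
  | nil => exact .inl (by simp [countKind, run])
  | append_singleton σ x ih =>
    have hσ' : IsInstance σ := fun y hy => hσ y (List.mem_append_left _ hy)
    rw [run_append_singleton]
    exact (serve_step β _ x).lastTinyOpening (hσ x (by simp)).1 (valid_run β hσ')
      (pairwise_firstFit_run β hσ') (ih hσ')

theorem lastCriticalOpening_run (β : ℝ) {σ : List ℝ} (hσ : IsInstance σ) :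
    LastCriticalOpening β (run β σ) := by
  induction σ using List.reverseRecOn with
  | nil => exact .inl (by simp [run])
  | append_singleton σ x ih =>
    have hvalid := valid_run β hσ
    have hff := pairwise_firstFit_run β hσ
    rw [run_append_singleton] at hvalid hff ⊢
    exact (serve_step β _ x).lastCriticalOpening (hσ x (by simp)).1 hvalid hff
      (ih fun y hy => hσ y (List.mem_append_left _ hy))

/-- The number of critical bins after serving `σ` with ratio `β`. -/
noncomputable def numCriticalBins (β : ℝ) (σ : List ℝ) : ℕ := countKind (run β σ) .critical

/-- The number of tiny bins after serving `σ` with ratio `β`. -/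
noncomputable def numTinyBins (β : ℝ) (σ : List ℝ) : ℕ := countKind (run β σ) .tiny

section RunBounds

variable {σ : List ℝ}

theorem length_run_le_add (β : ℝ) (hσ : IsInstance σ) :
    ((run β σ).length : ℝ) ≤
      numLarge σ + numSmall σ / 2 + 1 + numCriticalBins β σ + numTinyBins β σ := by
  have hlarge : (countKind (run β σ) .large : ℝ) ≤ numLarge σ := by
    rw [numLarge, ← (perm_run β σ).countP_eq]
    exact_mod_cast countKind_large_le_numLarge (valid_run β hσ)
  have hsmall : 2 * ((countKind (run β σ) .small : ℝ) - 1) ≤ numSmall σ := by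
    rw [numSmall, ← (perm_run β σ).countP_eq]
    exact two_mul_countKind_small_sub_one_le_numSmall (valid_run β hσ)
      (pairwise_firstFit_run β hσ)
  rw [length_eq_sum_countKind, numCriticalBins, numTinyBins]
  push_cast
  linarith

theorem kindSum_run_add_le_tinyVolume (β : ℝ) (hσ : IsInstance σ) :
    kindSum Bin.tinyLevel .critical (run β σ) + 2 / 3 * ((numTinyBins β σ : ℝ) - 1) ≤
      tinyVolume σ := by
  have htiny :=
    mul_countKind_tiny_sub_one_le_kindSum (valid_run β hσ) (pairwise_firstFit_run β hσ)
  rw [← tinyVolume_perm (perm_run β σ), numTinyBins]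
  linarith [kindSum_critical_add_kindSum_tiny_le_tinyVolume (valid_run β hσ)]

theorem numTinyBins_eq_zero_or (β : ℝ) (hσ : IsInstance σ) :
    numTinyBins β σ = 0 ∨ ∃ c : ℕ, c ≤ numCriticalBins β σ ∧
      β * (c + numTinyBins β σ - 1) ≤ c ∧
        1 / 6 * ((c : ℝ) - 1) + 2 / 3 * ((numTinyBins β σ : ℝ) - 1) ≤ tinyVolume σ := by
  have hvol := kindSum_run_add_le_tinyVolume β hσ
  exact (lastTinyOpening_run β hσ).imp_right
    fun ⟨c, hc, hβ, hfull⟩ => ⟨c, hc, hβ, by linarith⟩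

theorem numCriticalBins_le_or (β : ℝ) (hσ : IsInstance σ) :
    numCriticalBins β σ ≤ numCritical σ ∨
      0 < β ∧ numCriticalBins β σ ≤ β * (numCriticalBins β σ + numTinyBins β σ) + 1 ∧
        1 / 6 * ((numCriticalBins β σ : ℝ) - 1) + 2 / 3 * ((numTinyBins β σ : ℝ) - 1) ≤
          tinyVolume σ := by
  have hvol := kindSum_run_add_le_tinyVolume β hσ
  rcases lastCriticalOpening_run β hσ with hcrit | ⟨hβ, hcount, hfull⟩
  · left
    rw [numCritical, ← (perm_run β σ).countP_eq]
    exact countKind_critical_le_numCritical (valid_run β hσ) hcrit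
  · refine .inr ⟨hβ, hcount, ?_⟩
    rw [numCriticalBins]
    linarith

end RunBounds

section Ratio

variable {α β β' s : ℝ} {σ : List ℝ}

theorem length_run_le_of_numCriticalBins_le (hβ₀ : 0 ≤ β) (hβ₁ : β ≤ 1) (hσ : IsInstance σ)
    (hC : numCriticalBins β σ ≤ numCritical σ) :
    ((run β σ).length : ℝ) ≤ (1.5 + (1 - β) / (4 - 3 * β)) * binOpt σ + 9 := by
  have hpos : 0 < 4 - 3 * β := by linarith
  set ρ := (1 - β) / (4 - 3 * β) with hρ
  have hρ₀ : 0 ≤ ρ := div_nonneg (by linarith) hpos.le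
  have hρ₁ : ρ ≤ 1 / 4 := by
    rw [hρ, div_le_iff₀ hpos]
    linarith
  have hV : 0 ≤ tinyVolume σ := tinyVolume_nonneg fun x hx => (hσ x hx).1
  have hT : (numTinyBins β σ : ℝ) ≤ ρ * (6 * tinyVolume σ + 1) + 1 := by
    rcases numTinyBins_eq_zero_or β hσ with hzero | ⟨c, -, hratio, hvol⟩
    · rw [hzero, Nat.cast_zero]
      positivity
    · rw [← sub_le_iff_le_add, hρ, div_mul_eq_mul_div, le_div_iff₀ hpos]
      linarith [mul_le_mul_of_nonneg_left hvol (sub_nonneg.2 hβ₁)]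
  have hC' : (numCriticalBins β σ : ℝ) ≤ numCritical σ := by exact_mod_cast hC
  have hlarge : 0 ≤ ρ * numLarge σ := by positivity
  -- The multipliers are a dual solution of the linear program bounding the cost by `Opt`.
  linarith [length_run_le_add β hσ,
    mul_le_mul_of_nonneg_left (volume_le_binOpt hσ) (by linarith : 0 ≤ 6 * ρ),
    mul_le_mul_of_nonneg_left (numLarge_add_numCritical_add_numSmall_le hσ)
      (by linarith : 0 ≤ 1 / 2 - 2 * ρ),
    mul_le_mul_of_nonneg_left (numLarge_add_numCritical_le_binOpt hσ)
      (by linarith : 0 ≤ 1 / 2 - ρ)]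

theorem length_run_le_of_lt_numCriticalBins (hβ₁ : β ≤ 1) (hσ : IsInstance σ)
    (hC : numCritical σ < numCriticalBins β σ) :
    ((run β σ).length : ℝ) ≤ (1.5 + 9 * β / (8 - 6 * β)) * binOpt σ + 9 := by
  obtain ⟨hβ₀, hratio, hvol⟩ := (numCriticalBins_le_or β hσ).resolve_left hC.not_ge
  have hpos : 0 < 4 - 3 * β := by linarith
  have hq : 1.5 + 9 * β / (8 - 6 * β) = 6 / (4 - 3 * β) := by
    rw [show 8 - 6 * β = 2 * (4 - 3 * β) by ring, show (1.5 : ℝ) = 3 / 2 by norm_num]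
    field_simp
    ring
  rw [hq]
  set q := 6 / (4 - 3 * β) with hq
  have hq₀ : 3 / 2 ≤ q := by
    rw [hq, le_div_iff₀ hpos]
    linarith
  have hq₁ : q ≤ 6 := by
    rw [hq, div_le_iff₀ hpos]
    linarith
  have hM : (numCriticalBins β σ : ℝ) + numTinyBins β σ ≤ q * (tinyVolume σ + 4 / 3) := by
    rw [hq, div_mul_eq_mul_div, le_div_iff₀ hpos]
    linarith
  have hnontiny : 0 ≤ (q - 3 / 2) * (2 / 3 * (numLarge σ : ℝ) + 1 / 2 * numCritical σ +
      1 / 3 * numSmall σ) := mul_nonneg (by linarith) (by positivity)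
  linarith [length_run_le_add β hσ, (Nat.cast_nonneg (numCritical σ) : (0 : ℝ) ≤ _),
    mul_le_mul_of_nonneg_left (volume_le_binOpt hσ) (by linarith : 0 ≤ q)]

theorem length_run_le_of_transition (hσ : IsInstance σ) (hs : 0 < s) (hs₁ : s ≤ 1) (hsβ : s ≤ β)
    (hβ₁ : β ≤ 1) (hβ' : β' ≤ β + s ^ 2) (hC : numCriticalBins β σ ≤ numCritical σ)
    (hC' : numCritical σ < numCriticalBins β' σ) :
    ((run β σ).length : ℝ) ≤ (1.5 + 6 * s) * binOpt σ + 9 := by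
  obtain ⟨-, hratio', hvol'⟩ := (numCriticalBins_le_or β' hσ).resolve_left hC'.not_ge
  have hβ : 0 < β := hs.trans_le hsβ
  have hlength := length_run_le_add β hσ
  have hvolume := volume_le_binOpt hσ
  have hCQ : (numCriticalBins β σ : ℝ) ≤ numCritical σ := by exact_mod_cast hC
  have hQC' : (numCritical σ : ℝ) + 1 ≤ numCriticalBins β' σ := by exact_mod_cast hC'
  rcases numTinyBins_eq_zero_or β hσ with hzero | ⟨c, hcC, hratio, -⟩
  · rw [hzero, Nat.cast_zero] at hlength
    linarith [numLarge_add_numCritical_add_numSmall_le hσ, numLarge_add_numCritical_le_binOpt hσ,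
      show 0 ≤ s * (binOpt σ : ℝ) by positivity]
  set M : ℝ := numCriticalBins β' σ + numTinyBins β' σ with hM
  have hM₀ : 0 ≤ M := by positivity
  have hβM : β' * M ≤ β * (1 + s) * M := by
    refine mul_le_mul_of_nonneg_right ?_ hM₀
    nlinarith
  have hQ : (numCritical σ : ℝ) ≤ β * (1 + s) * M := by linarith
  have hβT : β * ((numTinyBins β σ : ℝ) - 1) ≤ (1 - β) * numCritical σ := by
    have hcQ : (c : ℝ) ≤ numCritical σ := by exact_mod_cast hcC.trans hC
    linarith [mul_le_mul_of_nonneg_left hcQ (sub_nonneg.2 hβ₁)]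
  have hT : (numTinyBins β σ : ℝ) - 1 + numCritical σ / 4 ≤ (1 - 3 / 4 * β) * ((1 + s) * M) := by
    refine le_of_mul_le_mul_left ?_ hβ
    linarith [mul_le_mul_of_nonneg_left hQ (by linarith : 0 ≤ 1 - 3 / 4 * β)]
  have hsM : s * M ≤ s * (6 * tinyVolume σ + 5) := by
    gcongr
    linarith [hM, (Nat.cast_nonneg (numTinyBins β' σ) : (0 : ℝ) ≤ _)]
  have hsV : s * tinyVolume σ ≤ s * binOpt σ := by
    gcongr
    refine le_trans (le_add_of_nonneg_left ?_) hvolume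
    positivity
  linarith [hM]

theorem length_run_le_max (hβ₀ : 0 ≤ β) (hβα : β ≤ α) (hα₁ : α ≤ 1) (hσ : IsInstance σ) :
    ((run β σ).length : ℝ) ≤
      (1.5 + max (1 / 4) (9 * α / (8 - 6 * α))) * binOpt σ + 9 := by
  rcases le_or_gt (numCriticalBins β σ) (numCritical σ) with hC | hC
  · refine (length_run_le_of_numCriticalBins_le hβ₀ (hβα.trans hα₁) hσ hC).trans ?_
    have hρ : (1 - β) / (4 - 3 * β) ≤ 1 / 4 := by
      rw [div_le_iff₀ (by linarith)]
      linarith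
    gcongr
    exact hρ.trans (le_max_left _ _)
  · refine (length_run_le_of_lt_numCriticalBins (hβα.trans hα₁) hσ hC).trans ?_
    have hmono : 9 * β / (8 - 6 * β) ≤ 9 * α / (8 - 6 * α) := by
      have : 0 < 8 - 6 * α := by linarith
      gcongr
      linarith
    gcongr
    exact hmono.trans (le_max_right _ _)

end Ratio

theorem exists_lt_and_not_succ {p : ℕ → Prop} {n : ℕ} (hn : 0 < n) (hp : p 0) :
    ∃ j < n, p j ∧ (j + 1 < n → ¬ p (j + 1)) := by
  classical
  refine ⟨Nat.findGreatest p (n - 1), ?_, Nat.findGreatest_spec (Nat.zero_le _) hp,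
    fun hj => Nat.findGreatest_is_greatest (Nat.lt_succ_self _) (by omega)⟩
  exact (Nat.findGreatest_le _).trans_lt (Nat.sub_lt hn one_pos)

theorem one_sub_min_div_le {α s : ℝ} (hs : 0 ≤ s) (hs₁ : s ≤ 1) :
    (1 - min α (1 - s ^ 2)) / (4 - 3 * min α (1 - s ^ 2)) ≤
      max ((1 - α) / (4 - 3 * α)) (7.5 * s) := by
  rcases min_choice α (1 - s ^ 2) with h | h <;> rw [h]
  · exact le_max_left _ _
  · refine le_max_of_le_right ?_
    rw [div_le_iff₀ (by nlinarith)]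
    nlinarith [pow_nonneg hs 3]

theorem numCriticalBins_zero_le {σ : List ℝ} (hσ : IsInstance σ) :
    numCriticalBins 0 σ ≤ numCritical σ :=
  (numCriticalBins_le_or 0 hσ).resolve_right fun h => h.1.false

theorem length_run_le_of_le_add_sq {β s : ℝ} {σ : List ℝ} (hs : 0 ≤ s) (hs₂ : s ≤ 1 / 2)
    (hβ : β ≤ s + s ^ 2) (hσ : IsInstance σ) (hC : numCritical σ < numCriticalBins β σ) :
    ((run β σ).length : ℝ) ≤ (1.5 + 7.5 * s) * binOpt σ + 9 := by
  have hβ₁ : β ≤ 3 / 4 := by nlinarith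
  refine (length_run_le_of_lt_numCriticalBins (by linarith) hσ hC).trans ?_
  gcongr
  rw [div_le_iff₀ (by linarith)]
  nlinarith

theorem exists_min_div_length_run_le {α s : ℝ} {σ : List ℝ} {n : ℕ} (hα₀ : 0 ≤ α) (hα₁ : α ≤ 1)
    (hs : 0 < s) (hn : n * s ^ 2 = 1) (hσ : IsInstance σ) :
    ∃ j < n, ((run (min α (j / n)) σ).length : ℝ) ≤
      (1.5 + max ((1 - α) / (4 - 3 * α)) (7.5 * s)) * binOpt σ + 9 := by
  have hn₀ : 0 < n := Nat.pos_of_ne_zero fun h => by simp [h] at hn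
  have hn₁ : (1 : ℝ) ≤ n := by exact_mod_cast hn₀
  have hs₁ : s ≤ 1 := by nlinarith
  have hsn : 1 / (n : ℝ) = s ^ 2 := (eq_one_div_of_mul_eq_one_right hn).symm
  suffices h : ∃ j < n, ∃ ρ ≤ max ((1 - α) / (4 - 3 * α)) (7.5 * s),
      ((run (min α (j / n)) σ).length : ℝ) ≤ (1.5 + ρ) * binOpt σ + 9 by
    obtain ⟨j, hj, ρ, hρ, hlength⟩ := h
    exact ⟨j, hj, hlength.trans (by gcongr)⟩
  have hβ₀ (j : ℕ) : 0 ≤ min α ((j : ℝ) / n) := le_min hα₀ (by positivity)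
  have hβ₁ (j : ℕ) : min α ((j : ℝ) / n) ≤ 1 := (min_le_left _ _).trans hα₁
  have hzero : min α (((0 : ℕ) : ℝ) / n) = 0 := by simpa using hα₀
  have hC₀ := hzero ▸ numCriticalBins_zero_le hσ
  rcases lt_or_ge (1 / 2) s with hs₂ | hs₂
  · refine ⟨0, hn₀, _, le_max_of_le_right ?_,
      length_run_le_of_numCriticalBins_le (hβ₀ 0) (hβ₁ 0) hσ hC₀⟩
    rw [hzero]
    linarith
  obtain ⟨j, hj, hC, hC'⟩ := exists_lt_and_not_succ
    (p := fun j => numCriticalBins (min α ((j : ℝ) / n)) σ ≤ numCritical σ) hn₀ hC₀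
  rcases (Nat.succ_le_of_lt hj).eq_or_lt with hlast | hj'
  · refine ⟨j, hj, _, ?_, length_run_le_of_numCriticalBins_le (hβ₀ j) (hβ₁ j) hσ hC⟩
    have hjn : (j : ℝ) / n = 1 - s ^ 2 := by
      rw [← hsn, ← hlast, Nat.cast_succ]
      field_simp
      ring
    rw [hjn]
    exact one_sub_min_div_le hs.le hs₁
  have hC' := not_le.1 (hC' hj')
  have hstep : min α (((j + 1 : ℕ) : ℝ) / n) ≤ min α ((j : ℝ) / n) + s ^ 2 := by
    rw [min_add, ← hsn, Nat.cast_succ, add_div]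
    exact min_le_min_right _ (le_add_of_nonneg_right (by positivity))
  rcases le_or_gt s (min α ((j : ℝ) / n)) with hsβ | hβs
  · exact ⟨j, hj, _, le_max_of_le_right (by linarith),
      length_run_le_of_transition hσ hs hs₁ hsβ (hβ₁ j) hstep hC hC'⟩
  · exact ⟨j + 1, hj', _, le_max_right _ _,
      length_run_le_of_le_add_sq hs.le hs₂ (by linarith) hσ hC'⟩

theorem place_le_length (L : List Bin) (x : ℝ) : place L x ≤ L.length := by
  obtain ⟨κ, hplace, -⟩ := place_eq_firstIdx L x
  exact hplace ▸ firstIdx_le_length L _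

theorem lt_length_step_iff {β x : ℝ} {L : List Bin} {j : ℕ} :
    j < (step β L x).length ↔ j < L.length ∨ place L x = j := by
  have := place_le_length L x
  unfold step
  split_ifs with h
  · rw [List.length_modify]
    omega
  · rw [List.length_append, List.length_singleton]
    omega

theorem exists_place_eq_iff {β : ℝ} {σ : List ℝ} {j : ℕ} :
    (∃ (i : ℕ) (_ : i < σ.length), place (run β (σ.take i)) σ[i] = j) ↔
      j < (run β σ).length := by
  induction σ using List.reverseRecOn with
  | nil => simp [run]
  | append_singleton σ x ih =>
    rw [run_append_singleton, lt_length_step_iff, ← ih]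
    constructor
    · rintro ⟨i, hi, h⟩
      rw [List.length_append, List.length_singleton, Nat.lt_succ_iff_lt_or_eq] at hi
      rcases hi with hi | rfl
      · exact .inl ⟨i, hi, by simpa [List.take_append_of_le_length, hi.le, hi] using h⟩
      · exact .inr (by simpa using h)
    · rintro (⟨i, hi, h⟩ | h)
      · exact ⟨i, by grind, by simpa [List.take_append_of_le_length, hi.le, hi] using h⟩
      · exact ⟨σ.length, by simp, by simpa using h⟩

/-- The total size of the items in the `j`-th bin of `L`, and `0` if there is no such bin. -/
noncomputable def levelAt (L : List Bin) (j : ℕ) : ℝ := (L.map Bin.level).getD j 0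

theorem levelAt_le_one {L : List Bin} (hL : ∀ b ∈ L, b.level ≤ 1) (j : ℕ) : levelAt L j ≤ 1 := by
  rcases lt_or_ge j L.length with hj | hj
  · simpa [levelAt, List.getD_eq_getElem?_getD, hj] using hL _ (List.getElem_mem hj)
  · simp [levelAt, List.getD_eq_getElem?_getD, hj]

theorem levelAt_step (β : ℝ) (L : List Bin) (x : ℝ) (j : ℕ) :
    levelAt (step β L x) j = levelAt L j + if place L x = j then x else 0 := by
  have := place_le_length L x
  simp only [levelAt, step, List.getD_eq_getElem?_getD, List.getElem?_map]
  split_ifs with hlt hj hj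
  · subst hj
    simp [hlt, Bin.level]
  · simp [hj]
  · obtain rfl : L.length = j := by omega
    simp [Bin.level]
  · rcases lt_or_gt_of_ne (show j ≠ L.length by omega) with hj' | hj'
    · simp [List.getElem?_append, hj']
    · simp [List.getElem?_append, hj'.not_gt, Nat.sub_ne_zero_of_lt hj']

section Tape

variable (α : ℝ) (σ : List ℝ) (φ : List Bool)

theorem packing_rrcTape (i : Fin σ.length) :
    (rrcTape α).packing σ φ i = place (run (min α (fraction φ)) (σ.take i)) σ[i] := by
  rw [OnlineAlg.packing, rrcTape, ← List.take_append_getElem i.isLt, List.dropLast_concat,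
    List.getLastD_concat]
  rfl

theorem sum_filter_packing_rrcTape (j : ℕ) :
    ∑ i ∈ Finset.univ.filter (fun i => (rrcTape α).packing σ φ i = j), σ.get i =
      levelAt (run (min α (fraction φ)) σ) j := by
  set level : ℕ → ℝ := fun m => levelAt (run (min α (fraction φ)) (σ.take m)) j
  have hlevel (i : Fin σ.length) :
      (if (rrcTape α).packing σ φ i = j then σ.get i else 0) = level (i + 1) - level i := by
    simp only [level, packing_rrcTape, ← List.take_append_getElem i.isLt, run_append_singleton,
      levelAt_step]
    exact (add_sub_cancel_left _ _).symm
  calc ∑ i ∈ Finset.univ.filter (fun i => (rrcTape α).packing σ φ i = j), σ.get i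
      = ∑ i : Fin σ.length, (level (i + 1) - level i) := by
        rw [Finset.sum_filter, Finset.sum_congr rfl fun i _ => hlevel i]
    _ = level σ.length - level 0 := by
        rw [← Finset.sum_range fun m => level (m + 1) - level m, Finset.sum_range_sub]
    _ = levelAt (run (min α (fraction φ)) σ) j := by
        simp [level, run, levelAt]

theorem cost_rrcTape : (rrcTape α).cost σ φ = (run (min α (fraction φ)) σ).length := by
  have himage : Finset.univ.image ((rrcTape α).packing σ φ) =
      Finset.range (run (min α (fraction φ)) σ).length := by
    ext j
    simp only [Finset.mem_image, Finset.mem_univ, true_and, Finset.mem_range,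
      ← exists_place_eq_iff, packing_rrcTape, Fin.exists_iff]
    rfl
  rw [OnlineAlg.cost, numBins, himage, Finset.card_range]

theorem rrcTape_feasible : (rrcTape α).Feasible := fun σ hσ φ j =>
  (sum_filter_packing_rrcTape α σ φ j).trans_le
    (levelAt_le_one (fun b hb => (valid_run _ hσ b hb).level_le_one) j)

end Tape

theorem fraction_nonneg (φ : List Bool) : 0 ≤ fraction φ := by
  induction φ with
  | nil => exact le_rfl
  | cons b φ ih =>
    rw [fraction]
    positivity

theorem exists_fraction_eq {k i : ℕ} (hi : i < 2 ^ k) :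
    ∃ φ : List Bool, φ.length = k ∧ fraction φ = i / 2 ^ k := by
  induction k generalizing i with
  | zero =>
    obtain rfl : i = 0 := by simpa using hi
    exact ⟨[], rfl, by simp [fraction]⟩
  | succ k ih =>
    rw [pow_succ] at hi
    rcases lt_or_ge i (2 ^ k) with h | h
    · obtain ⟨φ, hlen, hφ⟩ := ih h
      refine ⟨false :: φ, by rw [List.length_cons, hlen], ?_⟩
      rw [fraction, hφ, if_neg Bool.false_ne_true, zero_add, div_div, pow_succ]
    · obtain ⟨φ, hlen, hφ⟩ := ih (i := i - 2 ^ k) (by omega)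
      refine ⟨true :: φ, by rw [List.length_cons, hlen], ?_⟩
      rw [fraction, hφ, if_pos rfl, Nat.cast_sub h]
      push_cast
      field_simp
      ring

section Competitive

variable {α : ℝ} {σ : List ℝ}

theorem cost_rrcTape_le (hα₀ : 0 ≤ α) (hα₁ : α ≤ 1) (hσ : IsInstance σ) (φ : List Bool) :
    ((rrcTape α).cost σ φ : ℝ) ≤ (1.5 + max (1 / 4) (9 * α / (8 - 6 * α))) * binOpt σ + 9 := by
  rw [cost_rrcTape]
  exact length_run_le_max (le_min hα₀ (fraction_nonneg φ)) (min_le_left _ _) hα₁ hσ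

theorem exists_cost_rrcTape_le (hα₀ : 0 ≤ α) (hα₁ : α ≤ 1) (k : ℕ) (hσ : IsInstance σ) :
    ∃ φ : List Bool, φ.length = k ∧ ((rrcTape α).cost σ φ : ℝ) ≤
      (1.5 + max ((1 - α) / (4 - 3 * α)) (15 / (2 : ℝ) ^ ((k : ℝ) / 2 + 1))) * binOpt σ + 9 := by
  set s : ℝ := ((2 : ℝ) ^ ((k : ℝ) / 2))⁻¹ with hs
  have hsq : ((2 ^ k : ℕ) : ℝ) * s ^ 2 = 1 := by
    rw [hs, inv_pow, ← Real.rpow_mul_natCast zero_le_two]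
    simp
  have hbound : 15 / (2 : ℝ) ^ ((k : ℝ) / 2 + 1) = 7.5 * s := by
    rw [hs, Real.rpow_add_one two_ne_zero]
    field_simp
    norm_num
  obtain ⟨i, hi, hlength⟩ :=
    exists_min_div_length_run_le hα₀ hα₁ (s := s) (by positivity) hsq hσ
  obtain ⟨φ, hlen, hφ⟩ := exists_fraction_eq hi
  refine ⟨φ, hlen, ?_⟩
  rw [cost_rrcTape, hφ, hbound]
  exact_mod_cast hlength

theorem rrc_feasible (α : ℝ) (k : ℕ) : (rrc α k).Feasible :=
  fun σ hσ φ => rrcTape_feasible α σ hσ (φ.take k)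

theorem rrc_hasAdviceComplexity (α : ℝ) (k : ℕ) : (rrc α k).HasAdviceComplexity fun _ => k :=
  fun σ _ _ h => congrArg ((rrcTape α).packing σ) h

theorem rrc_trustedRatioLE (hα₀ : 0 ≤ α) (hα₁ : α ≤ 1) (k : ℕ) :
    (rrc α k).TrustedRatioLE
      (1.5 + max ((1 - α) / (4 - 3 * α)) (15 / (2 : ℝ) ^ ((k : ℝ) / 2 + 1))) := by
  refine ⟨9, fun σ hσ => ?_⟩
  obtain ⟨φ, hlen, hφ⟩ := exists_cost_rrcTape_le hα₀ hα₁ k hσ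
  have hcost : (rrc α k).cost σ φ = (rrcTape α).cost σ (φ.take k) := rfl
  exact ⟨φ, by rwa [hcost, List.take_of_length_le hlen.le]⟩

theorem rrcTape_untrustedRatioLE (hα₀ : 0 ≤ α) (hα₁ : α ≤ 1) :
    (rrcTape α).UntrustedRatioLE (1.5 + max (1 / 4) (9 * α / (8 - 6 * α))) :=
  ⟨9, fun _ hσ φ => cost_rrcTape_le hα₀ hα₁ hσ φ⟩

theorem rrc_untrustedRatioLE (hα₀ : 0 ≤ α) (hα₁ : α ≤ 1) (k : ℕ) :
    (rrc α k).UntrustedRatioLE (1.5 + max (1 / 4) (9 * α / (8 - 6 * α))) :=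
  ⟨9, fun _ hσ φ => cost_rrcTape_le hα₀ hα₁ hσ (φ.take k)⟩

theorem exists_div_two_rpow_le {ε : ℝ} (hε : 0 < ε) :
    ∃ k : ℕ, 15 / (2 : ℝ) ^ ((k : ℝ) / 2 + 1) ≤ ε := by
  obtain ⟨n, hn⟩ := pow_unbounded_of_one_lt (15 / ε) (one_lt_two : (1 : ℝ) < 2)
  refine ⟨2 * n, ?_⟩
  have hexp : ((2 * n : ℕ) : ℝ) / 2 + 1 = (n + 1 : ℕ) := by
    push_cast
    ring
  rw [hexp, Real.rpow_natCast, div_le_comm₀ (by positivity) hε]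
  exact hn.le.trans (pow_le_pow_right₀ one_le_two n.le_succ)

theorem rrcTape_trustedRatioLE (hα₀ : 0 ≤ α) (hα₁ : α ≤ 1) :
    (rrcTape α).TrustedRatioLE (1.5 + (1 - α) / (4 - 3 * α)) := by
  refine ⟨10, fun σ hσ => ?_⟩
  obtain ⟨k, hk⟩ := exists_div_two_rpow_le (ε := 1 / (binOpt σ + 1)) (by positivity)
  obtain ⟨φ, -, hφ⟩ := exists_cost_rrcTape_le hα₀ hα₁ k hσ
  refine ⟨φ, hφ.trans ?_⟩
  have hρ : 0 ≤ (1 - α) / (4 - 3 * α) := div_nonneg (by linarith) (by linarith)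
  calc (1.5 + max ((1 - α) / (4 - 3 * α)) (15 / (2 : ℝ) ^ ((k : ℝ) / 2 + 1))) * binOpt σ + 9
      ≤ (1.5 + ((1 - α) / (4 - 3 * α) + 1 / (binOpt σ + 1))) * binOpt σ + 9 := by
        gcongr
        exact (max_le_add_of_nonneg hρ (by positivity)).trans (by gcongr)
    _ = (1.5 + (1 - α) / (4 - 3 * α)) * binOpt σ + binOpt σ / (binOpt σ + 1) + 9 := by ring
    _ ≤ (1.5 + (1 - α) / (4 - 3 * α)) * binOpt σ + 10 := by
        have : (binOpt σ : ℝ) / (binOpt σ + 1) ≤ 1 :=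
          (div_le_one (by positivity)).2 (le_add_of_nonneg_right zero_le_one)
        linarith

end Competitive

theorem exists_parameter_of_ratio {r : ℝ} (hr : 1.5 ≤ r) : ∃ α : ℝ, 0 ≤ α ∧ α ≤ 1 ∧
    1.5 + (1 - α) / (4 - 3 * α) ≤ r ∧
      1.5 + max (1 / 4) (9 * α / (8 - 6 * α)) ≤ max (33 - 18 * r) (7 / 4) := by
  rcases le_or_gt r (7 / 4) with hr' | hr'
  · have hD : 0 < 11 - 6 * r := by linarith
    obtain ⟨α, hα⟩ : ∃ α, α = (14 - 8 * r) / (11 - 6 * r) := ⟨_, rfl⟩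
    have hα₀ : 0 ≤ α := hα ▸ div_nonneg (by linarith) hD.le
    have hα₁ : α ≤ 1 := by
      rw [hα, div_le_one hD]
      linarith
    rw [eq_div_iff hD.ne'] at hα
    have htrusted : (1 - α) / (4 - 3 * α) = r - 3 / 2 := by
      rw [div_eq_iff (by linarith)]
      linarith
    have huntrusted : 9 * α / (8 - 6 * α) = 63 / 2 - 18 * r := by
      rw [div_eq_iff (by linarith)]
      linarith
    refine ⟨α, hα₀, hα₁, by linarith, ?_⟩
    rw [huntrusted, ← max_add_add_left, max_comm]
    exact max_le_max (by linarith) (by norm_num)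
  · exact ⟨0, le_rfl, zero_le_one, by linarith, le_max_of_le_right (by norm_num)⟩

end RRC

theorem mainTheorem5 :
    (∀ (α : ℝ), 0 ≤ α → α ≤ 1 → ∀ k : ℕ,
      (RRC.rrc α k).Feasible ∧
      (RRC.rrc α k).HasAdviceComplexity (fun _ => k) ∧
      (RRC.rrc α k).TrustedRatioLE
        (1.5 + max ((1 - α) / (4 - 3 * α)) (15 / (2 : ℝ) ^ ((k : ℝ) / 2 + 1))) ∧
      (RRC.rrc α k).UntrustedRatioLE
        (1.5 + max (1 / 4) (9 * α / (8 - 6 * α)))) ∧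
    (∀ r : ℝ, 1.5 ≤ r → ∃ α : ℝ, 0 ≤ α ∧ α ≤ 1 ∧
      (RRC.rrcTape α).IsCompetitive r (max (33 - 18 * r) (7 / 4)) ∧
      (1.5 < r → ∃ k : ℕ, (RRC.rrc α k).IsCompetitive r (max (33 - 18 * r) (7 / 4)))) := by
  refine ⟨fun α hα₀ hα₁ k => ⟨RRC.rrc_feasible α k, RRC.rrc_hasAdviceComplexity α k,
    RRC.rrc_trustedRatioLE hα₀ hα₁ k, RRC.rrc_untrustedRatioLE hα₀ hα₁ k⟩, fun r hr => ?_⟩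
  obtain ⟨α, hα₀, hα₁, htrusted, huntrusted⟩ := RRC.exists_parameter_of_ratio hr
  refine ⟨α, hα₀, hα₁, ⟨RRC.rrcTape_feasible α, (RRC.rrcTape_trustedRatioLE hα₀ hα₁).mono htrusted,
    (RRC.rrcTape_untrustedRatioLE hα₀ hα₁).mono huntrusted⟩, fun hr' => ?_⟩
  obtain ⟨k, hk⟩ := RRC.exists_div_two_rpow_le (sub_pos.2 hr')
  have hmax : 1.5 + max ((1 - α) / (4 - 3 * α)) (15 / (2 : ℝ) ^ ((k : ℝ) / 2 + 1)) ≤ r :=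
    le_sub_iff_add_le'.1 (max_le (le_sub_iff_add_le'.2 htrusted) hk)
  exact ⟨k, RRC.rrc_feasible α k, (RRC.rrc_trustedRatioLE hα₀ hα₁ k).mono hmax,
    (RRC.rrc_untrustedRatioLE hα₀ hα₁ k).mono huntrusted⟩
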